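/- Let $n\ge 0$, let $[n]=\{1,\dots,n\}$ with its usual order, and let $[n]^*$ be the free monoid of words over $[n]$, with empty word $\epsilon$. Partially order $[n]^*$ by composition order: $u\le w$ if and only if $w$ has a subword $w(i_1)w(i_2)\cdots w(i_l)$ with $i_1<\cdots<i_l$, $l=\ell(u)$, and $u(j)\le w(i_j)$ for $1\le j\le l$. Let $\zeta$ and $\mu$ be the zeta function and the Möbius function of this locally finite poset. Let $\mathbb Z\langle\langle [n]^2\rangle\rangle$ be the algebra of all formal series $f=\sum_{u,w\in[n]^*}c_{u,w}\,u\otimes w$ with $c_{u,w}\in\mathbb Z$, where $(u\otimes w)(u'\otimes w')=uu'\otimes ww'$. If $f$ has no constant term, i.e. $c_{\epsilon,\epsilon}=0$, put $f^*=\epsilon\otimes\epsilon+f+f^2+f^3+\cdots$. A series is called rational if it can be constructed from a finite set of monomials $u\otimes w$ by finitely many applications of the algebra operations ($\mathbb Z$-linear combinations and products) and of the operation $f\mapsto f^*$ on series without constant term. **Theorem.** In $\mathbb Z\langle\langle [n]^2\rangle\rangle$ the series $$Z_\otimes=\sum_{u,w\in[n]^*}\zeta(u,w)\,u\otimes w\qquad\text{and}\qquad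 M_\otimes=\sum_{u,w\in[n]^*}\mu(u,w)\,u\otimes w$$ are rational. -/

import Mathlib

/-! ### Words over a poset and the (generalized) composition order -/

namespace CompositionPoset

/-- The alphabet `[n] = {1, …, n}`, with the order of the natural numbers. -/
abbrev Letter (n : ℕ) : Type := Set.Icc (1 : ℕ) n

/-- Composition order on words: `u ≤ w` iff `w` has a subword `w(i₁) ⋯ w(iₗ)`, `l = ℓ(u)`, with
`u(j) ≤ w(iⱼ)` for all `j` (see `le_iff`). -/
instance instLE {A : Type*} [PartialOrder A] : LE (FreeMonoid A) where
  le u w := List.SublistForall₂ (· ≤ ·) u.toList w.toList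

theorem le_iff {A : Type*} [PartialOrder A] (u w : FreeMonoid A) :
    u ≤ w ↔ ∃ v : List A, List.Forall₂ (· ≤ ·) u.toList v ∧ v.Sublist w.toList :=
  List.sublistForall₂_iff

theorem length_le {A : Type*} [PartialOrder A] {u w : FreeMonoid A} (h : u ≤ w) :
    u.toList.length ≤ w.toList.length := by
  obtain ⟨v, h1, h2⟩ := (le_iff u w).1 h
  exact h1.length_eq.trans_le h2.length_le

theorem le_antisymm' {A : Type*} [PartialOrder A] {u w : FreeMonoid A} (h : u ≤ w) (h' : w ≤ u) :
    u = w := by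
  have key : ∀ {x y : FreeMonoid A}, x ≤ y → y ≤ x →
      List.Forall₂ (· ≤ ·) x.toList y.toList := by
    intro x y h h'
    obtain ⟨v, h1, h2⟩ := (le_iff x y).1 h
    have : v = y.toList := h2.eq_of_length_le (by rw [← h1.length_eq]; exact length_le h')
    exact this ▸ h1
  have e : ∀ {l m : List A}, List.Forall₂ (· ≤ ·) l m → List.Forall₂ (· ≤ ·) m l → l = m := by
    intro l m h
    induction h with
    | nil => intro _; rfl
    | cons ha _ ih =>
      intro h'
      cases h' with
      | cons hb hr => rw [le_antisymm ha hb, ih hr]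
  exact FreeMonoid.toList.injective (e (key h h') (key h' h))

instance instPartialOrder {A : Type*} [PartialOrder A] : PartialOrder (FreeMonoid A) where
  le_refl u := (List.SublistForall₂.is_refl (Rₐ := ((· ≤ ·) : A → A → Prop))).refl u.toList
  le_trans u v w h h' :=
    (List.SublistForall₂.is_trans (Rₐ := ((· ≤ ·) : A → A → Prop))).trans
      u.toList v.toList w.toList h h'
  le_antisymm _ _ h h' := le_antisymm' h h'

theorem finite_Icc {A : Type*} [PartialOrder A] [Finite A] (u w : FreeMonoid A) :
    (Set.Icc u w).Finite :=
  (List.finite_length_le A w.toList.length).subset fun _ hv => length_le hv.2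

/-- Intervals in composition order over a finite alphabet are finite, so that the incidence algebra
and its Möbius function are available. -/
noncomputable instance instLocallyFiniteOrder {A : Type*} [PartialOrder A] [Finite A] :
    LocallyFiniteOrder (FreeMonoid A) :=
  LocallyFiniteOrder.ofFiniteIcc finite_Icc

/-! ### Formal power series over a monoid, with integer coefficients

A series `∑ c_x x` over a monoid `X` is its coefficient function `X → ℤ`. -/

/-- The monomial `x`. -/
noncomputable def monomial {X : Type*} (x : X) : X → ℤ :=
  open Classical in Pi.single x 1

/-- The Cauchy product: the coefficient of `x` in `f g` is the sum of `f y * g z` over all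
factorizations `x = y z`. -/
noncomputable def cauchyMul {X : Type*} [Monoid X] (f g : X → ℤ) : X → ℤ :=
  fun x => ∑ᶠ p ∈ {p : X × X | p.1 * p.2 = x}, f p.1 * g p.2

/-- Powers for the Cauchy product. -/
noncomputable def cauchyPow {X : Type*} [Monoid X] (f : X → ℤ) : ℕ → X → ℤ
  | 0 => monomial 1
  | k + 1 => cauchyMul f (cauchyPow f k)

/-- `f* = 1 + f + f² + f³ + ⋯`, coefficientwise. It is used only for `f` without constant term. -/
noncomputable def seriesStar {X : Type*} [Monoid X] (f : X → ℤ) : X → ℤ :=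
  fun x => ∑ᶠ k : ℕ, cauchyPow f k x

/-- A series is rational if it can be constructed from finitely many monomials by finitely many
algebra operations (linear combinations over `ℤ`, products) and applications of `*` to series
without constant term. -/
inductive IsRational {X : Type*} [Monoid X] : (X → ℤ) → Prop
  | monomial (x : X) : IsRational (monomial x)
  | smul (c : ℤ) {f : X → ℤ} (hf : IsRational f) : IsRational (c • f)
  | add {f g : X → ℤ} (hf : IsRational f) (hg : IsRational g) : IsRational (f + g)
  | mul {f g : X → ℤ} (hf : IsRational f) (hg : IsRational g) : IsRational (cauchyMul f g)
  | star {f : X → ℤ} (hf : IsRational f) (h0 : f 1 = 0) : IsRational (seriesStar f)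

/-! ### Series in the elements `u ⊗ w`

The elements `u ⊗ w` form the monoid `A* × A*`, with `(u ⊗ w)(u' ⊗ w') = uu' ⊗ ww'`. In it, the
sums that define products and stars are finite. -/

theorem finite_factorizations {A : Type*} (x : FreeMonoid A × FreeMonoid A) :
    {p : (FreeMonoid A × FreeMonoid A) × (FreeMonoid A × FreeMonoid A) |
      p.1 * p.2 = x}.Finite := by
  have hw : ∀ u : FreeMonoid A, {p : FreeMonoid A × FreeMonoid A | p.1 * p.2 = u}.Finite := by
    intro u
    refine ((Set.finite_Iic u.toList.length).image fun i =>
      (FreeMonoid.ofList (u.toList.take i), FreeMonoid.ofList (u.toList.drop i))).subset ?_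
    rintro ⟨a, b⟩ rfl
    refine ⟨a.toList.length, by simp, ?_⟩
    simp
  refine (((hw x.1).prod (hw x.2)).image fun q =>
    ((q.1.1, q.2.1), (q.1.2, q.2.2))).subset ?_
  rintro ⟨⟨a, b⟩, ⟨c, d⟩⟩ rfl
  exact ⟨((a, c), (b, d)), ⟨rfl, rfl⟩, rfl⟩

theorem cauchyPow_eq_zero {A : Type*} {f : FreeMonoid A × FreeMonoid A → ℤ} (h0 : f 1 = 0)
    (k : ℕ) : ∀ x : FreeMonoid A × FreeMonoid A,
      x.1.toList.length + x.2.toList.length < k → cauchyPow f k x = 0 := by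
  induction k with
  | zero => intro x hx; omega
  | succ k ih =>
    intro x hx
    refine finsum_mem_eq_zero_of_forall_eq_zero ?_
    rintro ⟨⟨a, b⟩, ⟨c, d⟩⟩ rfl
    by_cases h : ((a, b) : FreeMonoid A × FreeMonoid A) = 1
    · simp [h, h0]
    · have hpos : 0 < a.toList.length + b.toList.length := by
        by_contra hn
        apply h
        have ha : a.toList = [] := List.length_eq_zero_iff.1 (by omega)
        have hb : b.toList = [] := List.length_eq_zero_iff.1 (by omega)
        exact Prod.ext (FreeMonoid.toList.injective ha) (FreeMonoid.toList.injective hb)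
      have := ih (c, d) (by simp at hx ⊢; omega)
      simp [this]

theorem finite_support_cauchyPow {A : Type*} {f : FreeMonoid A × FreeMonoid A → ℤ} (h0 : f 1 = 0)
    (x : FreeMonoid A × FreeMonoid A) : (Function.support fun k => cauchyPow f k x).Finite :=
  (Set.finite_Iic (x.1.toList.length + x.2.toList.length)).subset fun k hk => by
    by_contra hn
    exact hk (cauchyPow_eq_zero h0 k x (by simpa using hn))

/-- `Z_⊗ = ∑ ζ(u, w) u ⊗ w`, with the zeta function of the poset `[n]*`. -/
noncomputable def zetaSeries (n : ℕ) : FreeMonoid (Letter n) × FreeMonoid (Letter n) → ℤ :=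
  open Classical in fun x => IncidenceAlgebra.zeta ℤ x.1 x.2

/-- `M_⊗ = ∑ μ(u, w) u ⊗ w`, with the Möbius function of the poset `[n]*`. -/
noncomputable def moebiusSeries (n : ℕ) : FreeMonoid (Letter n) × FreeMonoid (Letter n) → ℤ :=
  open Classical in fun x => IncidenceAlgebra.mu ℤ x.1 x.2

end CompositionPoset

/-! Both series have explicit rational expressions.

For zeta, `u ≤ w` holds exactly when the greedy leftmost embedding of `u` in `w` succeeds
(`cons_le_cons_iff`). That embedding is unique: for each letter `a` of `u` it skips letters below
`a`, then takes the first letter `c ≥ a`; what remains of `w` is arbitrary. Hence `Z = (∑ₐ (∑_{b<a}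
1⊗b)* (∑_{c≥a} a⊗c))* (∑_b 1⊗b)*`.

For Möbius, `M = (∑_b (b⊗b - (b-1)⊗b)(1⊗b)*)*`, where `b-1` is the empty word if `b = 1`. For fixed
`w` the coefficients of this star form a finite combination of words, `moebiusRow w none`. Replacing
a first letter `c` by `c-1` affects `a :: u ≤ c :: v` only if `a = c` (`leInd_cons_sub_lower`). The
error term this leaves is cancelled by deleting runs of equal letters, so summing the row over words
`≥ u` gives `[u = w]` (`pairing_moebiusRow`). This characterizes `μ(·, w)`. -/

namespace CompositionPoset

/-! ### The ring of formal series. -/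

section Series

variable {A : Type*}

theorem cauchyMul_eq_sum (f g : FreeMonoid A × FreeMonoid A → ℤ)
    (x : FreeMonoid A × FreeMonoid A) :
    cauchyMul f g x = ∑ p ∈ (finite_factorizations x).toFinset, f p.1 * g p.2 :=
  finsum_mem_eq_finite_toFinset_sum _ (finite_factorizations x)

theorem cauchyMul_assoc (f g h : FreeMonoid A × FreeMonoid A → ℤ) :
    cauchyMul (cauchyMul f g) h = cauchyMul f (cauchyMul g h) := by
  funext x
  simp only [cauchyMul_eq_sum, Finset.sum_mul, Finset.mul_sum]
  rw [Finset.sum_sigma', Finset.sum_sigma']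
  refine Finset.sum_bij' (fun p _ => ⟨(p.2.1, p.2.2 * p.1.2), (p.2.2, p.1.2)⟩)
    (fun p _ => ⟨(p.1.1 * p.2.1, p.2.2), (p.1.1, p.2.1)⟩) ?_ ?_ ?_ ?_ ?_
  · rintro ⟨⟨a, b⟩, ⟨c, d⟩⟩ hp
    simp only [Finset.mem_sigma, Set.Finite.mem_toFinset, Set.mem_ofPred_eq] at hp ⊢
    rw [← mul_assoc, hp.2]
    exact ⟨hp.1, trivial⟩
  · rintro ⟨⟨a, b⟩, ⟨c, d⟩⟩ hp
    simp only [Finset.mem_sigma, Set.Finite.mem_toFinset, Set.mem_ofPred_eq] at hp ⊢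
    rw [mul_assoc, hp.2]
    exact ⟨hp.1, trivial⟩
  · rintro ⟨⟨a, b⟩, ⟨c, d⟩⟩ hp
    simp only [Finset.mem_sigma, Set.Finite.mem_toFinset, Set.mem_ofPred_eq] at hp
    simp only [hp.2]
  · rintro ⟨⟨a, b⟩, ⟨c, d⟩⟩ hp
    simp only [Finset.mem_sigma, Set.Finite.mem_toFinset, Set.mem_ofPred_eq] at hp
    simp only [hp.2]
  · rintro ⟨⟨a, b⟩, ⟨c, d⟩⟩ hp
    exact mul_assoc _ _ _

theorem cauchyMul_monomial_left_apply (x z : FreeMonoid A × FreeMonoid A)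
    (f : FreeMonoid A × FreeMonoid A → ℤ) : cauchyMul (monomial x) f (x * z) = f z := by
  classical
  rw [cauchyMul_eq_sum, Finset.sum_eq_single (x, z)]
  · simp [monomial]
  · rintro ⟨p, q⟩ hp hne
    simp only [Set.Finite.mem_toFinset, Set.mem_ofPred_eq] at hp
    by_cases h : p = x
    · subst h
      exact absurd (by rw [mul_left_cancel hp]) hne
    · simp [monomial, h]
  · simp

theorem cauchyMul_monomial_left_eq_zero (x y : FreeMonoid A × FreeMonoid A)
    (f : FreeMonoid A × FreeMonoid A → ℤ) (h : ∀ z, x * z ≠ y) :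
    cauchyMul (monomial x) f y = 0 := by
  classical
  rw [cauchyMul_eq_sum]
  refine Finset.sum_eq_zero ?_
  rintro ⟨p, q⟩ hp
  simp only [Set.Finite.mem_toFinset, Set.mem_ofPred_eq] at hp
  have : p ≠ x := by
    rintro rfl
    exact h q hp
  simp [monomial, this]

theorem one_cauchyMul (f : FreeMonoid A × FreeMonoid A → ℤ) :
    cauchyMul (monomial 1) f = f := by
  funext x
  simpa using cauchyMul_monomial_left_apply 1 x f

theorem cauchyMul_one (f : FreeMonoid A × FreeMonoid A → ℤ) :
    cauchyMul f (monomial 1) = f := by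
  classical
  funext x
  rw [cauchyMul_eq_sum, Finset.sum_eq_single (x, 1)]
  · simp [monomial]
  · rintro ⟨p, q⟩ hp hne
    simp only [Set.Finite.mem_toFinset, Set.mem_ofPred_eq] at hp
    by_cases h : q = 1
    · subst h
      exact absurd (by rw [← hp, mul_one]) hne
    · simp [monomial, h]
  · simp

theorem cauchyMul_add (f g h : FreeMonoid A × FreeMonoid A → ℤ) :
    cauchyMul f (g + h) = cauchyMul f g + cauchyMul f h := by
  funext x
  simp [cauchyMul_eq_sum, mul_add, Finset.sum_add_distrib]

theorem add_cauchyMul (f g h : FreeMonoid A × FreeMonoid A → ℤ) :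
    cauchyMul (f + g) h = cauchyMul f h + cauchyMul g h := by
  funext x
  simp [cauchyMul_eq_sum, add_mul, Finset.sum_add_distrib]

theorem zero_cauchyMul (f : FreeMonoid A × FreeMonoid A → ℤ) : cauchyMul 0 f = 0 := by
  funext x
  simp [cauchyMul_eq_sum]

theorem cauchyMul_zero (f : FreeMonoid A × FreeMonoid A → ℤ) : cauchyMul f 0 = 0 := by
  funext x
  simp [cauchyMul_eq_sum]

theorem cauchyMul_apply_one (f g : FreeMonoid A × FreeMonoid A → ℤ) :
    cauchyMul f g 1 = f 1 * g 1 := by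
  rw [cauchyMul_eq_sum, Finset.sum_eq_single (1, 1)]
  · rintro ⟨⟨a, b⟩, ⟨c, d⟩⟩ hp hne
    simp only [Set.Finite.mem_toFinset, Set.mem_ofPred_eq] at hp
    obtain ⟨ha, hc⟩ := List.append_eq_nil_iff.1 (congrArg Prod.fst hp)
    obtain ⟨hb, hd⟩ := List.append_eq_nil_iff.1 (congrArg Prod.snd hp)
    exact absurd (Prod.ext (Prod.ext ha hb) (Prod.ext hc hd)) hne
  · simp

/-- At each `x` the star is a finite sum, since powers beyond the total length of `x` vanish there.
-/
theorem seriesStar_eq (f : FreeMonoid A × FreeMonoid A → ℤ) (h0 : f 1 = 0) :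
    seriesStar f = monomial 1 + cauchyMul f (seriesStar f) := by
  have key : ∀ (N : ℕ) (x : FreeMonoid A × FreeMonoid A),
      x.1.toList.length + x.2.toList.length < N →
        seriesStar f x = ∑ k ∈ Finset.range N, cauchyPow f k x := by
    intro N x hx
    refine finsum_eq_sum_of_support_subset _ fun k hk => ?_
    by_contra hn
    refine hk (cauchyPow_eq_zero h0 k x ?_)
    simp only [Finset.coe_range, Set.mem_Iio] at hn
    omega
  funext x
  -- One extra term is for `k = 0`, which is split off; the remaining range still exceeds the length
  -- of every right factor of `x`.
  rw [key (x.1.toList.length + x.2.toList.length + 1 + 1) x (by omega),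
    Finset.sum_range_succ', add_comm, Pi.add_apply]
  congr 1
  simp only [cauchyPow, cauchyMul_eq_sum]
  rw [Finset.sum_comm]
  refine Finset.sum_congr rfl ?_
  rintro ⟨⟨a, b⟩, ⟨c, d⟩⟩ hp
  simp only [Set.Finite.mem_toFinset, Set.mem_ofPred_eq] at hp
  subst hp
  rw [key _ (c, d) ?_, Finset.mul_sum]
  simp
  omega

/-- Formal series in the elements `u ⊗ w`, as a ring under the Cauchy product. -/
def Series (A : Type*) : Type _ := FreeMonoid A × FreeMonoid A → ℤ

noncomputable instance : AddCommGroup (Series A) :=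
  inferInstanceAs (AddCommGroup (FreeMonoid A × FreeMonoid A → ℤ))

noncomputable instance : Ring (Series A) where
  mul f g := cauchyMul f g
  one := monomial 1
  left_distrib f g h := cauchyMul_add f g h
  right_distrib f g h := add_cauchyMul f g h
  zero_mul f := zero_cauchyMul f
  mul_zero f := cauchyMul_zero f
  mul_assoc f g h := cauchyMul_assoc f g h
  one_mul f := one_cauchyMul f
  mul_one f := cauchyMul_one f
  neg_add_cancel f := neg_add_cancel f
  -- The pointwise action, so that `IsRational.smul` applies definitionally.
  zsmul := fun n f => n • f
  zsmul_zero' f := zero_zsmul f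
  zsmul_succ' n f := SubNegMonoid.zsmul_succ' n f
  zsmul_neg' n f := SubNegMonoid.zsmul_neg' n f

/-! ### Coefficients and closure properties of rational series. -/

namespace Series

/-- The coefficient of `u ⊗ w`. -/
def coeff (u w : List A) : Series A →+ ℤ where
  toFun f := f (FreeMonoid.ofList u, FreeMonoid.ofList w)
  map_zero' := rfl
  map_add' _ _ := rfl

/-- The monomial `u ⊗ w`. -/
noncomputable def tmul (u w : List A) : Series A :=
  monomial (FreeMonoid.ofList u, FreeMonoid.ofList w)

/-- `f* = 1 + f + f² + ⋯`. -/
noncomputable def star (f : Series A) : Series A := seriesStar f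

theorem coeff_one (u w : List A) :
    coeff u w 1 = open Classical in if u = [] ∧ w = [] then 1 else 0 := by
  have h : (FreeMonoid.ofList u, FreeMonoid.ofList w) = (1 : FreeMonoid A × FreeMonoid A) ↔
      u = [] ∧ w = [] := Prod.ext_iff
  change monomial 1 (FreeMonoid.ofList u, FreeMonoid.ofList w) = _
  by_cases hc : u = [] ∧ w = []
  · rw [h.2 hc, if_pos hc]
    simp [monomial]
  · rw [if_neg hc]
    simp [monomial, mt h.1 hc]

theorem coeff_nil_mul (f g : Series A) :
    coeff [] [] (f * g) = coeff [] [] f * coeff [] [] g :=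
  cauchyMul_apply_one f g

theorem coeff_tmul_mul_append (s t u w : List A) (f : Series A) :
    coeff (s ++ u) (t ++ w) (tmul s t * f) = coeff u w f :=
  cauchyMul_monomial_left_apply (FreeMonoid.ofList s, FreeMonoid.ofList t)
    (FreeMonoid.ofList u, FreeMonoid.ofList w) f

theorem coeff_tmul_mul_eq_zero (s t u w : List A) (f : Series A)
    (h : ¬ (s <+: u ∧ t <+: w)) : coeff u w (tmul s t * f) = 0 := by
  refine cauchyMul_monomial_left_eq_zero _ _ f ?_
  rintro ⟨z, z'⟩ hz
  exact h ⟨⟨z.toList, congrArg Prod.fst hz⟩, ⟨z'.toList, congrArg Prod.snd hz⟩⟩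

theorem coeff_nil_tmul {s t : List A} (h : t ≠ []) : coeff [] [] (tmul s t) = 0 := by
  rw [← mul_one (tmul s t)]
  exact coeff_tmul_mul_eq_zero _ _ _ _ _ fun h' => h (List.prefix_nil.1 h'.2)

theorem star_eq (f : Series A) (h0 : coeff [] [] f = 0) : star f = 1 + f * star f :=
  seriesStar_eq f h0

/-- Turns a star into the linear equation `X = g + f X`, from which coefficients are computed by
recursion on `w`. -/
theorem star_mul_eq (f g : Series A) (h0 : coeff [] [] f = 0) :
    star f * g = g + f * (star f * g) := by
  conv_lhs => rw [star_eq f h0]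
  rw [add_mul, one_mul, mul_assoc]

theorem coeff_tmul_nil_singleton_mul [DecidableEq A] (b c : A) (u w : List A) (f : Series A) :
    coeff u (c :: w) (tmul [] [b] * f) = if b = c then coeff u w f else 0 := by
  split_ifs with h
  · subst h
    exact coeff_tmul_mul_append [] [b] u w f
  · exact coeff_tmul_mul_eq_zero _ _ _ _ _ fun h' => h (by simpa using h'.2)

theorem coeff_tmul_mul_nil (s : List A) (b : A) (u : List A) (f : Series A) :
    coeff u [] (tmul s [b] * f) = 0 :=
  coeff_tmul_mul_eq_zero _ _ _ _ _ fun h => by simpa using h.2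

theorem coeff_nil_tmul_singleton_mul (a b : A) (w : List A) (f : Series A) :
    coeff [] w (tmul [a] [b] * f) = 0 :=
  coeff_tmul_mul_eq_zero _ _ _ _ _ fun h => by simpa using h.1

theorem coeff_tmul_singleton_singleton_mul [DecidableEq A] (a b a' c : A) (u w : List A) (f : Series A) :
    coeff (a' :: u) (c :: w) (tmul [a] [b] * f) =
      if b = c then if a = a' then coeff u w f else 0 else 0 := by
  split_ifs with h h'
  · subst h h'
    exact coeff_tmul_mul_append [a] [b] u w f
  · exact coeff_tmul_mul_eq_zero _ _ _ _ _ fun h1 => h' (by simpa using h1.1)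
  · exact coeff_tmul_mul_eq_zero _ _ _ _ _ fun h1 => h (by simpa using h1.2)

/-- Treats `s = [b]` and `s = lower b` uniformly, although the latter may be empty. -/
theorem coeff_tmul_singleton_mul [DecidableEq A] (s : List A) (b c : A) (u w : List A)
    (f : Series A) (m : List A →₀ ℤ) (h : ∀ u, coeff u w f = m u) :
    coeff u (c :: w) (tmul s [b] * f) = if b = c then m.mapDomain (s ++ ·) u else 0 := by
  split_ifs with hbc
  · subst hbc
    by_cases hs : s <+: u
    · obtain ⟨u, rfl⟩ := hs
      rw [Finsupp.mapDomain_apply (List.append_right_injective s), ← h]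
      exact coeff_tmul_mul_append s [b] u w f
    · rw [Finsupp.mapDomain_of_notMem_range]
      · exact coeff_tmul_mul_eq_zero _ _ _ _ _ fun h' => hs h'.1
      · rintro ⟨v, rfl⟩
        exact hs (List.prefix_append _ _)
  · exact coeff_tmul_mul_eq_zero _ _ _ _ _ fun h1 => hbc (by simpa using h1.2)

/-- The sum of all `1 ⊗ b`. -/
noncomputable def skipAny (A : Type*) [Fintype A] : Series A := ∑ b : A, tmul [] [b]

theorem coeff_nil_skipAny [Fintype A] : coeff [] [] (skipAny A) = 0 := by
  rw [skipAny, map_sum]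
  exact Finset.sum_eq_zero fun b _ => coeff_nil_tmul (by simp)

/-- Rationality of a series. -/
def Rational (f : Series A) : Prop := CompositionPoset.IsRational f

namespace Rational

theorem tmul (u w : List A) : (tmul u w).Rational := IsRational.monomial _

theorem zsmul (c : ℤ) {f : Series A} (hf : f.Rational) : (c • f).Rational := IsRational.smul c hf

theorem add {f g : Series A} (hf : f.Rational) (hg : g.Rational) : (f + g).Rational := IsRational.add hf hg

theorem mul {f g : Series A} (hf : f.Rational) (hg : g.Rational) : (f * g).Rational := IsRational.mul hf hg

theorem star {f : Series A} (hf : f.Rational) (h0 : coeff [] [] f = 0) : f.star.Rational :=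
  IsRational.star hf h0

theorem sub {f g : Series A} (hf : f.Rational) (hg : g.Rational) : (f - g).Rational := by
  rw [sub_eq_add_neg, ← neg_one_zsmul]
  exact hf.add (hg.zsmul _)

theorem sum {ι : Type*} (s : Finset ι) (f : ι → Series A)
    (hf : ∀ i ∈ s, (f i).Rational) : (∑ i ∈ s, f i).Rational := by
  classical
  induction s using Finset.induction_on with
  | empty =>
    rw [Finset.sum_empty, ← zero_zsmul (Series.tmul [] [])]
    exact (tmul _ _).zsmul 0
  | insert i s hi ih =>
    rw [Finset.sum_insert hi]
    exact (hf i (by simp)).add (ih fun j hj => hf j (by simp [hj]))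

end Rational

end Series

end Series

end CompositionPoset
namespace CompositionPoset

/-! ### The zeta series: greedy embeddings. -/

section Zeta

variable {A : Type*} [LinearOrder A]

/-- Matching `a` with `c` as soon as `a ≤ c` loses nothing: an embedding of `a :: u` that skips `c`
restricts to an embedding of `u` in `w`. -/
theorem cons_le_cons_iff (a c : A) (u w : List A) :
    FreeMonoid.ofList (a :: u) ≤ FreeMonoid.ofList (c :: w) ↔
      if a ≤ c then FreeMonoid.ofList u ≤ FreeMonoid.ofList w
      else FreeMonoid.ofList (a :: u) ≤ FreeMonoid.ofList w := by
  have tail : FreeMonoid.ofList u ≤ FreeMonoid.ofList (a :: u) :=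
    List.SublistForall₂.cons_right (le_refl (FreeMonoid.ofList u))
  constructor
  · intro h
    cases h with
    | cons h1 h2 => rw [if_pos h1]; exact h2
    | cons_right h2 =>
      split_ifs
      · exact tail.trans h2
      · exact h2
  · split_ifs with hac
    · exact fun h => List.SublistForall₂.cons hac h
    · exact fun h => List.SublistForall₂.cons_right h

theorem nil_le (w : List A) : FreeMonoid.ofList ([] : List A) ≤ FreeMonoid.ofList w :=
  List.SublistForall₂.nil

theorem not_cons_le_nil (a : A) (u : List A) :
    ¬ FreeMonoid.ofList (a :: u) ≤ FreeMonoid.ofList ([] : List A) := by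
  intro h
  cases h

open Classical in
/-- The indicator of `u ≤ w` in composition order. -/
noncomputable def leInd (u w : List A) : ℤ :=
  if FreeMonoid.ofList u ≤ FreeMonoid.ofList w then 1 else 0

theorem leInd_nil (w : List A) : leInd [] w = 1 := if_pos (nil_le w)

theorem leInd_cons_nil (a : A) (u : List A) : leInd (a :: u) [] = 0 := if_neg (not_cons_le_nil a u)

theorem leInd_cons_cons (a c : A) (u w : List A) :
    leInd (a :: u) (c :: w) = if a ≤ c then leInd u w else leInd (a :: u) w := by
  have h := cons_le_cons_iff a c u w
  split_ifs at h ⊢ <;> rw [leInd, propext h, leInd]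

namespace Series

variable [Fintype A]

/-- The sum of all `1 ⊗ b` with `b < a`. -/
noncomputable def skipBelow (a : A) : Series A :=
  ∑ b ∈ Finset.univ.filter (· < a), tmul [] [b]

/-- The sum of all `a ⊗ c` with `a ≤ c`. -/
noncomputable def matchLetter (a : A) : Series A :=
  ∑ c ∈ Finset.univ.filter (a ≤ ·), tmul [a] [c]

/-- The series of one greedy step: skip letters below `a`, then match `a`. -/
noncomputable def greedyStep (A : Type*) [LinearOrder A] [Fintype A] : Series A :=
  ∑ a : A, star (skipBelow a) * matchLetter a

/-- The rational expression for the zeta series, from greedy leftmost embeddings. -/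
noncomputable def zetaExpr (A : Type*) [LinearOrder A] [Fintype A] : Series A :=
  star (greedyStep A) * star (skipAny A)

theorem coeff_nil_skipBelow (a : A) : coeff [] [] (skipBelow a) = 0 := by
  rw [skipBelow, map_sum]
  exact Finset.sum_eq_zero fun b _ => coeff_nil_tmul (by simp)

theorem coeff_nil_matchLetter (a : A) : coeff [] [] (matchLetter a) = 0 := by
  rw [matchLetter, map_sum]
  exact Finset.sum_eq_zero fun b _ => coeff_nil_tmul (by simp)

theorem coeff_nil_greedyStep : coeff [] [] (greedyStep A) = 0 := by
  rw [greedyStep, map_sum]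
  exact Finset.sum_eq_zero fun b _ => by rw [coeff_nil_mul, coeff_nil_matchLetter, mul_zero]

theorem rational_zetaExpr : (zetaExpr A).Rational := by
  refine (Rational.star (Rational.sum _ _ fun a _ => ?_) coeff_nil_greedyStep).mul
    (Rational.star (Rational.sum _ _ fun b _ => .tmul _ _) coeff_nil_skipAny)
  exact (Rational.star (Rational.sum _ _ fun b _ => .tmul _ _) (coeff_nil_skipBelow a)).mul
    (Rational.sum _ _ fun b _ => .tmul _ _)

theorem coeff_star_skipAny (u w : List A) :
    coeff u w (star (skipAny A)) = if u = [] then 1 else 0 := by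
  induction w with
  | nil =>
    rw [star_eq _ coeff_nil_skipAny, skipAny, Finset.sum_mul, map_add, map_sum, coeff_one]
    simp [coeff_tmul_mul_nil]
  | cons c w ih =>
    rw [star_eq _ coeff_nil_skipAny, map_add, coeff_one]
    conv_lhs => enter [2, 2, 1]; rw [skipAny]
    rw [Finset.sum_mul, map_sum]
    simp [coeff_tmul_nil_singleton_mul, ih]

/-- The part of the zeta series in which `u` starts with `a`. -/
noncomputable def zetaExprFrom (a : A) : Series A :=
  star (skipBelow a) * (matchLetter a * zetaExpr A)

theorem zetaExpr_eq : zetaExpr A = star (skipAny A) + ∑ a : A, zetaExprFrom a := by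
  rw [zetaExpr, star_mul_eq _ _ coeff_nil_greedyStep]
  conv_lhs => enter [2, 1]; rw [greedyStep]
  simp only [Finset.sum_mul, zetaExprFrom, zetaExpr, mul_assoc]

theorem zetaExprFrom_eq (a : A) :
    zetaExprFrom a = matchLetter a * zetaExpr A + skipBelow a * zetaExprFrom a :=
  star_mul_eq _ _ (coeff_nil_skipBelow a)

theorem coeff_zetaExprFrom_nil (a : A) (u : List A) : coeff u [] (zetaExprFrom a) = 0 := by
  rw [zetaExprFrom_eq, matchLetter, skipBelow, Finset.sum_mul, Finset.sum_mul, map_add, map_sum,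
    map_sum]
  simp [coeff_tmul_mul_nil]

theorem coeff_zetaExprFrom_nil_left (a : A) (w : List A) : coeff [] w (zetaExprFrom a) = 0 := by
  induction w with
  | nil => exact coeff_zetaExprFrom_nil a []
  | cons c w ih =>
    rw [zetaExprFrom_eq, matchLetter, skipBelow, Finset.sum_mul, Finset.sum_mul, map_add, map_sum,
      map_sum]
    simp [coeff_nil_tmul_singleton_mul, coeff_tmul_nil_singleton_mul, ih]

/-- The order being total, exactly one of `matchLetter a` and `skipBelow a` can consume `c`. This is
the recursion of `leInd_cons_cons`. -/
theorem coeff_zetaExprFrom_cons_cons (a a' c : A) (u w : List A) :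
    coeff (a' :: u) (c :: w) (zetaExprFrom a) =
      if a ≤ c then if a = a' then coeff u w (zetaExpr A) else 0
      else coeff (a' :: u) w (zetaExprFrom a) := by
  conv_lhs => rw [zetaExprFrom_eq]
  rw [matchLetter, skipBelow, Finset.sum_mul, Finset.sum_mul, map_add, map_sum,
    map_sum]
  simp only [coeff_tmul_singleton_singleton_mul, coeff_tmul_nil_singleton_mul,
    Finset.sum_ite_eq', Finset.mem_filter, Finset.mem_univ, true_and]
  by_cases h : a ≤ c
  · simp [h]
  · simp [h, not_le.1 h]

theorem coeff_zetaExpr (u w : List A) : coeff u w (zetaExpr A) = leInd u w := by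
  have key : (∀ u, coeff u w (zetaExpr A) = leInd u w) ∧
      ∀ a a' u, coeff (a' :: u) w (zetaExprFrom a) = if a = a' then leInd (a' :: u) w else 0 := by
    -- A nonempty `u` has a single first letter, so for each `w` the first claim follows from the
    -- second.
    have hZ : ∀ w : List A,
        (∀ a a' u, coeff (a' :: u) w (zetaExprFrom a) = if a = a' then leInd (a' :: u) w else 0) →
          ∀ u, coeff u w (zetaExpr A) = leInd u w := by
      intro w h u
      rw [zetaExpr_eq, map_add, map_sum, coeff_star_skipAny]
      cases u with
      | nil => simp [coeff_zetaExprFrom_nil_left, leInd_nil]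
      | cons a u => simp [h]
    induction w with
    | nil =>
      have h : ∀ (a a' : A) u, coeff (a' :: u) [] (zetaExprFrom a) =
          if a = a' then leInd (a' :: u) [] else 0 := by
        intro a a' u
        simp [coeff_zetaExprFrom_nil, leInd_cons_nil]
      exact ⟨hZ _ h, h⟩
    | cons c w ih =>
      have h : ∀ (a a' : A) u, coeff (a' :: u) (c :: w) (zetaExprFrom a) =
          if a = a' then leInd (a' :: u) (c :: w) else 0 := by
        intro a a' u
        rw [coeff_zetaExprFrom_cons_cons, ih.1, ih.2, leInd_cons_cons]
        split_ifs <;> simp_all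
      exact ⟨hZ _ h, h⟩
  exact key.1 u

end Series

end Zeta

end CompositionPoset
namespace CompositionPoset

/-! ### The Möbius function, computed row by row. -/

section Moebius

variable {n : ℕ}

/-- The word consisting of the letter `b - 1`, or the empty word if `b = 1`. -/
def lower (b : Letter n) : List (Letter n) :=
  if h : 2 ≤ b.1 then [⟨b.1 - 1, by have := b.2.2; constructor <;> omega⟩] else []

/-- The letter `c` can match `a` if `a ≤ c`, and `c - 1` can if `a < c`; these differ only at `a =
c`. The empty `lower c` for `c = 1` fits, as no letter lies below `1`. -/
theorem leInd_cons_sub_lower (a c : Letter n) (u v : List (Letter n)) :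
    leInd (a :: u) ([c] ++ v) - leInd (a :: u) (lower c ++ v) =
      if a = c then leInd u v - leInd (a :: u) v else 0 := by
  have h1 : 1 ≤ a.1 := a.2.1
  have h : leInd (a :: u) (lower c ++ v) = if a < c then leInd u v else leInd (a :: u) v := by
    rw [lower]
    split_ifs with h2 h3 h3
    · exact (leInd_cons_cons _ _ _ _).trans (if_pos (Nat.le_sub_one_of_lt h3))
    · exact (leInd_cons_cons _ _ _ _).trans
        (if_neg fun h4 => h3 ((Nat.le_sub_one_iff_lt (by omega)).1 h4))
    · exact absurd (show a.1 < c.1 from h3) (by omega)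
    · rfl
  rw [List.singleton_append, leInd_cons_cons, h]
  rcases lt_trichotomy a c with hac | hac | hac
  · rw [if_pos hac.le, if_pos hac, if_neg hac.ne, sub_self]
  · rw [if_pos hac.le, if_neg hac.not_lt, if_pos hac]
  · rw [if_neg hac.not_ge, if_neg (not_lt_of_gt hac), if_neg hac.ne', sub_self]

/-- The series `∑ μ(v, w) v` for `p = none`; for `p = some b`, the variant in which an initial run
of letters `b` of `w` may be deleted. -/
noncomputable def moebiusRow : List (Letter n) → Option (Letter n) → (List (Letter n) →₀ ℤ)
  | [], _ => Finsupp.single [] 1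
  | c :: w, p => (moebiusRow w (some c)).mapDomain ([c] ++ ·) -
      (moebiusRow w (some c)).mapDomain (lower c ++ ·) +
      if p = some c then moebiusRow w (some c) else 0

theorem moebiusRow_cons_some (b c : Letter n) (w : List (Letter n)) :
    moebiusRow (c :: w) (some b) =
      moebiusRow (c :: w) none + if b = c then moebiusRow w (some c) else 0 := by
  simp [moebiusRow]

/-- The linear extension of `v ↦ [u ≤ v]`. -/
noncomputable def pairing (u : List (Letter n)) : (List (Letter n) →₀ ℤ) →ₗ[ℤ] ℤ :=
  Finsupp.linearCombination ℤ (leInd u)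

theorem pairing_mapDomain_sub (u s t : List (Letter n)) (m : List (Letter n) →₀ ℤ) :
    pairing u (m.mapDomain (s ++ ·) - m.mapDomain (t ++ ·)) =
      m.sum fun v k => k * (leInd u (s ++ v) - leInd u (t ++ v)) := by
  rw [pairing, map_sub, Finsupp.linearCombination_mapDomain, Finsupp.linearCombination_mapDomain,
    Finsupp.linearCombination_apply, Finsupp.linearCombination_apply, ← Finsupp.sum_sub]
  simp [mul_sub]

theorem pairing_nil_moebiusRow_cons (c : Letter n) (w : List (Letter n)) :
    pairing [] (moebiusRow (c :: w) none) = 0 := by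
  rw [moebiusRow, if_neg (by simp), add_zero, pairing_mapDomain_sub]
  simp [leInd_nil]

theorem pairing_cons_moebiusRow_cons (a c : Letter n) (u w : List (Letter n)) :
    pairing (a :: u) (moebiusRow (c :: w) none) =
      if a = c then pairing u (moebiusRow w (some c)) - pairing (a :: u) (moebiusRow w (some c))
      else 0 := by
  rw [moebiusRow, if_neg (by simp), add_zero, pairing_mapDomain_sub]
  simp only [leInd_cons_sub_lower]
  split_ifs
  · rw [pairing, pairing, Finsupp.linearCombination_apply, Finsupp.linearCombination_apply,
      ← Finsupp.sum_sub]
    simp [mul_sub]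
  · simp

/-- By `pairing_cons_moebiusRow_cons` the induction step needs only a difference of two pairings
with `moebiusRow w (some b)`, so its value is carried along as a second claim. -/
theorem pairing_moebiusRow (u w : List (Letter n)) :
    pairing u (moebiusRow w none) = if u = w then 1 else 0 := by
  have key : (∀ u, pairing u (moebiusRow w none) = if u = w then 1 else 0) ∧
      ∀ b u, pairing u (moebiusRow w (some b)) - pairing (b :: u) (moebiusRow w (some b)) =
        if u = w then 1 else 0 := by
    induction w with
    | nil =>
      constructor
      · rintro (_ | ⟨a, u⟩) <;> simp [moebiusRow, pairing, leInd_nil, leInd_cons_nil]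
      · rintro b (_ | ⟨a, u⟩) <;> simp [moebiusRow, pairing, leInd_nil, leInd_cons_nil]
    | cons c w ih =>
      have h : ∀ u, pairing u (moebiusRow (c :: w) none) = if u = c :: w then 1 else 0 := by
        rintro (_ | ⟨a, u⟩)
        · simp [pairing_nil_moebiusRow_cons]
        · rw [pairing_cons_moebiusRow_cons]
          by_cases hac : a = c
          · subst hac
            simp [ih.2]
          · simp [hac]
      refine ⟨h, fun b u => ?_⟩
      -- The undeleted part contributes `[u = c :: w] - [b :: u = c :: w]`. If `b = c`, the deleted
      -- part adds `[u = w]`, which cancels the second term; otherwise that term is zero.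
      rw [moebiusRow_cons_some, map_add, map_add, h, h]
      by_cases hbc : b = c
      · subst hbc
        have := ih.2 b u
        simp only [if_true, List.cons.injEq, true_and]
        linarith
      · simp [hbc]
  exact key.1 u

/-- Letters are only kept, lowered or deleted. This places the rows in the incidence algebra. -/
theorem le_of_moebiusRow_ne_zero (w : List (Letter n)) (p : Option (Letter n))
    (v : List (Letter n)) (h : moebiusRow w p v ≠ 0) :
    FreeMonoid.ofList v ≤ FreeMonoid.ofList w := by
  induction w generalizing p v with
  | nil =>
    have : v = [] := by
      by_contra hv
      exact h (by simp [moebiusRow, Ne.symm hv])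
    rw [this]
  | cons c w ih =>
    have hc : ∀ v, FreeMonoid.ofList v ≤ FreeMonoid.ofList w →
        FreeMonoid.ofList v ≤ FreeMonoid.ofList (c :: w) :=
      fun v hv => List.SublistForall₂.cons_right hv
    have hmap : ∀ s : List (Letter n),
        ((moebiusRow w (some c)).mapDomain (s ++ ·)) v ≠ 0 →
          ∃ v', v = s ++ v' ∧ FreeMonoid.ofList v' ≤ FreeMonoid.ofList w := by
      intro s hs
      obtain ⟨v', hv', rfl⟩ := Finset.mem_image.1
        (Finsupp.mapDomain_support (Finsupp.mem_support_iff.2 hs))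
      exact ⟨v', rfl, ih _ _ (Finsupp.mem_support_iff.1 hv')⟩
    rw [moebiusRow] at h
    by_cases h1 : ((moebiusRow w (some c)).mapDomain ([c] ++ ·)) v = 0
    · by_cases h2 : ((moebiusRow w (some c)).mapDomain (lower c ++ ·)) v = 0
      · rw [Finsupp.add_apply, Finsupp.sub_apply, h1, h2] at h
        split_ifs at h
        · exact hc v (ih _ _ (by simpa using h))
        · simp at h
      · obtain ⟨v', rfl, hv'⟩ := hmap _ h2
        rw [lower]
        split_ifs with hc2
        · exact List.SublistForall₂.cons (Subtype.coe_le_coe.1 (Nat.sub_le _ _)) hv'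
        · exact hc _ hv'
    · obtain ⟨v', rfl, hv'⟩ := hmap _ h1
      exact List.SublistForall₂.cons le_rfl hv'

open Classical in
-- The rows form a right inverse of zeta, which must agree with the left inverse `μ`.
theorem mu_eq_moebiusRow (u w : List (Letter n)) :
    IncidenceAlgebra.mu ℤ (FreeMonoid.ofList u) (FreeMonoid.ofList w) = moebiusRow w none u := by
  let m : IncidenceAlgebra ℤ (FreeMonoid (Letter n)) :=
    ⟨fun u w => moebiusRow w.toList none u.toList, fun u w h => by
      by_contra h'
      exact h (le_of_moebiusRow_ne_zero _ _ _ h')⟩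
  have hm : IncidenceAlgebra.zeta ℤ * m = 1 := by
    ext u w
    rw [IncidenceAlgebra.mul_apply, IncidenceAlgebra.one_apply]
    have h : ∑ v ∈ (moebiusRow w.toList none).support.map FreeMonoid.ofList.toEmbedding,
        leInd u.toList v.toList * m v w = if u = w then 1 else 0 := by
      have h' := pairing_moebiusRow u.toList w.toList
      rw [pairing, Finsupp.linearCombination_apply, Finsupp.sum] at h'
      rw [Finset.sum_map]
      refine (Finset.sum_congr rfl fun v _ => mul_comm _ _).trans (h'.trans ?_)
      by_cases huw : u = w
      · rw [if_pos huw, if_pos (congrArg _ huw)]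
      · rw [if_neg huw, if_neg fun h => huw (FreeMonoid.toList.injective h)]
    rw [← h]
    -- The convolution runs over `Icc u w`, the pairing over the support of the row; a word in just
    -- one of these contributes zero.
    refine Finset.sum_congr_of_eq_on_inter ?_ ?_ ?_
    · intro v _ hv
      have hv' : m v w = 0 := by
        by_contra h0
        exact hv (Finset.mem_map.2 ⟨v.toList, Finsupp.mem_support_iff.2 h0, rfl⟩)
      rw [hv', mul_zero]
    · intro v hv hv'
      obtain ⟨v, hvs, rfl⟩ := Finset.mem_map.1 hv
      have hvw : FreeMonoid.ofList v ≤ w :=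
        le_of_moebiusRow_ne_zero w.toList none v (Finsupp.mem_support_iff.1 hvs)
      have huv : ¬ u ≤ FreeMonoid.ofList v := fun huv => hv' (Finset.mem_Icc.2 ⟨huv, hvw⟩)
      exact mul_eq_zero_of_left (if_neg huv) _
    · intro v hv _
      have huv : u ≤ v := (Finset.mem_Icc.1 hv).1
      rw [IncidenceAlgebra.zeta_apply, if_pos huv, show leInd u.toList v.toList = 1 from if_pos huv]
  have : IncidenceAlgebra.mu ℤ = m := by
    rw [← mul_one (IncidenceAlgebra.mu ℤ), ← hm, ← mul_assoc, IncidenceAlgebra.mu_mul_zeta, one_mul]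
  rw [this]
  rfl

/-! ### The Möbius series as a star. -/

namespace Series

/-- The series of a letter `b` of `w`, together with the later letters `b` deleted after it. -/
noncomputable def moebiusStep (n : ℕ) : Series (Letter n) :=
  ∑ b : Letter n, (tmul [b] [b] - tmul (lower b) [b]) * star (tmul [] [b])

/-- The rational expression for the Möbius series. -/
noncomputable def moebiusExpr (n : ℕ) : Series (Letter n) := star (moebiusStep n)

/-- The Möbius series with an initial run of letters `b` of `w` deleted. -/
noncomputable def moebiusExprFrom (b : Letter n) : Series (Letter n) :=
  star (tmul [] [b]) * moebiusExpr n

theorem coeff_nil_moebiusStep : coeff [] [] (moebiusStep n) = 0 := by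
  rw [moebiusStep, map_sum]
  refine Finset.sum_eq_zero fun b _ => ?_
  rw [coeff_nil_mul, map_sub, coeff_nil_tmul (by simp), coeff_nil_tmul (by simp), sub_zero,
    zero_mul]

theorem rational_moebiusExpr : (moebiusExpr n).Rational := by
  refine Rational.star (Rational.sum _ _ fun b _ => ?_) coeff_nil_moebiusStep
  exact ((Rational.tmul _ _).sub (.tmul _ _)).mul
    (Rational.star (.tmul _ _) (coeff_nil_tmul (by simp)))

theorem moebiusExpr_eq : moebiusExpr n =
    1 + ∑ b : Letter n, (tmul [b] [b] - tmul (lower b) [b]) * moebiusExprFrom b := by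
  conv_lhs => rw [moebiusExpr, star_eq _ coeff_nil_moebiusStep]
  conv_lhs => enter [2, 1]; rw [moebiusStep]
  simp only [Finset.sum_mul, moebiusExprFrom, moebiusExpr, mul_assoc]

theorem moebiusExprFrom_eq (b : Letter n) :
    moebiusExprFrom b = moebiusExpr n + tmul [] [b] * moebiusExprFrom b :=
  star_mul_eq _ _ (coeff_nil_tmul (by simp))

/-- `moebiusExpr_eq` and `moebiusExprFrom_eq` reproduce the mutual recursion of `moebiusRow` at
`none` and `some b`, so both are proved together. -/
theorem coeff_moebiusExpr (u w : List (Letter n)) :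
    coeff u w (moebiusExpr n) = moebiusRow w none u := by
  have key : (∀ u, coeff u w (moebiusExpr n) = moebiusRow w none u) ∧
      ∀ b u, coeff u w (moebiusExprFrom b) = moebiusRow w (some b) u := by
    induction w with
    | nil =>
      have h : ∀ u, coeff u [] (moebiusExpr n) = moebiusRow [] none u := by
        intro u
        rw [moebiusExpr_eq, map_add, map_sum, coeff_one]
        simp [sub_mul, coeff_tmul_mul_nil, moebiusRow, Finsupp.single_apply, eq_comm]
      refine ⟨h, fun b u => ?_⟩
      rw [moebiusExprFrom_eq, map_add, h, coeff_tmul_mul_nil, add_zero]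
      rfl
    | cons c w ih =>
      have h : ∀ u, coeff u (c :: w) (moebiusExpr n) = moebiusRow (c :: w) none u := by
        intro u
        rw [moebiusExpr_eq, map_add, map_sum, coeff_one]
        simp [sub_mul, coeff_tmul_singleton_mul _ _ _ _ _ _ _ (ih.2 _), moebiusRow]
      refine ⟨h, fun b u => ?_⟩
      rw [moebiusExprFrom_eq, map_add, h, coeff_tmul_nil_singleton_mul, moebiusRow_cons_some,
        ih.2]
      split_ifs with hbc <;> simp [hbc]
  exact key.1 u

end Series

end Moebius

end CompositionPoset

theorem mainTheorem2 (n : ℕ) :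
    CompositionPoset.IsRational (CompositionPoset.zetaSeries n) ∧
      CompositionPoset.IsRational (CompositionPoset.moebiusSeries n) := by
  classical
  have hz : CompositionPoset.zetaSeries n = CompositionPoset.Series.zetaExpr (CompositionPoset.Letter n) := by
    funext ⟨u, w⟩
    refine Eq.trans ?_ (CompositionPoset.Series.coeff_zetaExpr u.toList w.toList).symm
    rw [CompositionPoset.zetaSeries, IncidenceAlgebra.zeta_apply]
    rfl
  have hm : CompositionPoset.moebiusSeries n = CompositionPoset.Series.moebiusExpr n := by
    funext ⟨u, w⟩
    exact (CompositionPoset.mu_eq_moebiusRow u.toList w.toList).trans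
      (CompositionPoset.Series.coeff_moebiusExpr u.toList w.toList).symm
  rw [hz, hm]
  exact ⟨CompositionPoset.Series.rational_zetaExpr, CompositionPoset.Series.rational_moebiusExpr⟩
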